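/- Let $M$ be a connected (Hausdorff, boundaryless) smooth manifold of finite dimension $n$ with a continuous Riemannian metric $g$, and write $\|v\|_g=\sqrt{g_p(v,v)}$ for $v\in T_pM$. A path $\gamma:[0,1]\to M$ is *piecewise smooth* ($\gamma\in\mathcal A_\infty$) if it is continuous and there is a partition $0=t_0<\dots<t_N=1$ such that each restriction $\gamma|_{[t_{i-1},t_i]}$ is $C^\infty$ (up to the end points). It is *absolutely continuous* ($\gamma\in\mathcal A_{\mathrm{ac}}$) if it is continuous and, for every smooth chart $(u,U)$ of $M$, the map $u\circ\gamma$ is absolutely continuous (with respect to the Euclidean norm of $\mathbb R^n$) on every closed interval $[a,b]\subseteq\gamma^{-1}(U)$. Let $$d(p,q)=\inf\Big\{\int_0^1\|\gamma'(t)\|_g\,dt \;:\; \gamma\in\mathcal A_\infty,\ \gamma(0)=p,\ \gamma(1)=q\Big\}$$ be the distance induced by $g$, and for $\gamma,\sigma\in\mathcal A_{\mathrm{ac}}$ let $$D_{\mathrm{ac}}(\gamma,\sigma)=\sup_{t\in[0,1]}d(\gamma(t),\sigma(t))+\int_0^1\big|\,\|\gamma'(t)\|_g-\|\sigma'(t)\|_g\,\big|\,dt$$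 be the variational metric. **Theorem.** $\mathcal A_\infty\subseteq\mathcal A_{\mathrm{ac}}$, and $\mathcal A_\infty$ is dense in $\mathcal A_{\mathrm{ac}}$ with respect to the variational metric: for every $\gamma\in\mathcal A_{\mathrm{ac}}$ and every $\varepsilon>0$ there is $\sigma\in\mathcal A_\infty$ with $D_{\mathrm{ac}}(\gamma,\sigma)<\varepsilon$. Equivalently, $\mathcal A_\infty$ is dense in $\mathcal A_{\mathrm{ac}}$ in the topology induced by $D_{\mathrm{ac}}$. -/

import Mathlib

open Set MeasureTheory Bundle
open scoped Manifold ContDiff ENNReal Topology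

noncomputable section

namespace VariationalMetric

/-- A continuous Riemannian metric on the smooth `n`-manifold `M`: an inner product on each tangent
space, depending continuously on the base point. -/
abbrev ContRiemannianMetric (n : ℕ) (M : Type*) [TopologicalSpace M]
    [ChartedSpace (EuclideanSpace ℝ (Fin n)) M] [IsManifold (𝓡 n) ∞ M] :=
  ContinuousRiemannianMetric (EuclideanSpace ℝ (Fin n)) (fun x : M ↦ TangentSpace (𝓡 n) x)

/-- The path `γ` (a map on `ℝ` of which only the restriction to `[0, 1]` matters) is piecewise
smooth: it is continuous on `[0, 1]`, and smooth, up to the end points, on each closed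
interval of some partition `0 = t 0 < t 1 < ⋯ < t N = 1`. -/
def IsPiecewiseSmooth (n : ℕ) {M : Type*} [TopologicalSpace M]
    [ChartedSpace (EuclideanSpace ℝ (Fin n)) M] (γ : ℝ → M) : Prop :=
  ContinuousOn γ (Icc 0 1) ∧
    ∃ (N : ℕ) (t : ℕ → ℝ), t 0 = 0 ∧ t N = 1 ∧ (∀ i < N, t i < t (i + 1)) ∧
      ∀ i < N, ContMDiffOn 𝓘(ℝ, ℝ) (𝓡 n) ∞ γ (Icc (t i) (t (i + 1)))

/-- The path `γ` (a map on `ℝ` of which only the restriction to `[0, 1]` matters) is absolutely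
continuous: it is continuous on `[0, 1]` and, for each smooth chart `u` with domain `U`, the
composition `u ∘ γ` is locally absolutely continuous on `{t ∈ [0, 1] | γ t ∈ U}`, that is,
absolutely continuous on each closed interval contained in this set. -/
def IsAbsolutelyContinuous (n : ℕ) {M : Type*} [TopologicalSpace M]
    [ChartedSpace (EuclideanSpace ℝ (Fin n)) M] (γ : ℝ → M) : Prop :=
  ContinuousOn γ (Icc 0 1) ∧
    ∀ u ∈ IsManifold.maximalAtlas (𝓡 n) ∞ M, ∀ a b : ℝ, a ≤ b →
      Icc a b ⊆ Icc 0 1 ∩ γ ⁻¹' u.source → AbsolutelyContinuousOnInterval (u ∘ γ) a b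

section Metric

variable {n : ℕ} {M : Type*} [TopologicalSpace M]
  [ChartedSpace (EuclideanSpace ℝ (Fin n)) M] [IsManifold (𝓡 n) ∞ M]

/-- The norm `‖v‖_g = √(g_p(v, v))` of a tangent vector `v` at `p`. -/
def tangentNorm (g : ContRiemannianMetric n M) (p : M) (v : TangentSpace (𝓡 n) p) : ℝ :=
  √(g.inner p v v)

/-- The speed `‖γ'(t)‖_g` of a path. -/
def speed (g : ContRiemannianMetric n M) (γ : ℝ → M) (t : ℝ) : ℝ :=
  tangentNorm g (γ t) (mfderiv 𝓘(ℝ, ℝ) (𝓡 n) γ t (1 : ℝ))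

/-- The length `L(γ) = ∫₀¹ ‖γ'(t)‖_g dt`. -/
def length (g : ContRiemannianMetric n M) (γ : ℝ → M) : ℝ≥0∞ :=
  ∫⁻ t in Icc (0 : ℝ) 1, ENNReal.ofReal (speed g γ t)

/-- The distance induced by `g`: the infimum of the lengths of the piecewise smooth curves from `p`
to `q`. -/
def rDist (g : ContRiemannianMetric n M) (p q : M) : ℝ≥0∞ :=
  ⨅ (γ : ℝ → M) (_ : IsPiecewiseSmooth n γ ∧ γ 0 = p ∧ γ 1 = q), length g γ

end Metric

/-- A map `[0, 1] → M` as a map on the real line, extended by its values at the end points. -/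
abbrev extend {M : Type*} (γ : unitInterval → M) : ℝ → M :=
  IccExtend (zero_le_one : (0 : ℝ) ≤ 1) γ

/-- The class of absolutely continuous paths `[0, 1] → M`. -/
def ACPath (n : ℕ) (M : Type*) [TopologicalSpace M]
    [ChartedSpace (EuclideanSpace ℝ (Fin n)) M] : Type _ :=
  {γ : unitInterval → M // IsAbsolutelyContinuous n (extend γ)}

section Variational

variable {n : ℕ} {M : Type*} [TopologicalSpace M]
  [ChartedSpace (EuclideanSpace ℝ (Fin n)) M] [IsManifold (𝓡 n) ∞ M]

/-- The variational metric
`D_ac(γ, σ) = sup_t d(γ(t), σ(t)) + ∫₀¹ |‖γ'(t)‖_g - ‖σ'(t)‖_g| dt`. -/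
def variationalDist (g : ContRiemannianMetric n M) (γ σ : ACPath n M) : ℝ≥0∞ :=
  (⨆ t : unitInterval, rDist g (γ.1 t) (σ.1 t)) +
    ∫⁻ t in Icc (0 : ℝ) 1,
      ENNReal.ofReal |speed g (extend γ.1) t - speed g (extend σ.1) t|

/-- The topology of the variational metric: a set is open if and only if it contains an open
`D_ac`-ball around each of its points. -/
@[reducible] def variationalTopology (g : ContRiemannianMetric n M) : TopologicalSpace (ACPath n M) where
  IsOpen U := ∀ γ ∈ U, ∃ ε : ℝ≥0∞, 0 < ε ∧ ∀ σ, variationalDist g γ σ < ε → σ ∈ U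
  isOpen_univ := fun _ _ ↦ ⟨1, one_pos, fun _ _ ↦ mem_univ _⟩
  isOpen_inter := by
    intro U V hU hV γ hγ
    obtain ⟨ε, hε, h⟩ := hU γ hγ.1
    obtain ⟨δ, hδ, h'⟩ := hV γ hγ.2
    exact ⟨min ε δ, lt_min hε hδ, fun σ hσ ↦
      ⟨h σ (hσ.trans_le (min_le_left _ _)), h' σ (hσ.trans_le (min_le_right _ _))⟩⟩
  isOpen_sUnion := by
    intro S hS γ hγ
    obtain ⟨U, hU, hγU⟩ := hγ
    obtain ⟨ε, hε, h⟩ := hS U hU γ hγU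
    exact ⟨ε, hε, fun σ hσ ↦ ⟨U, hU, h σ hσ⟩⟩

end Variational

/-- The piecewise smooth curves, as a subset of the absolutely continuous ones. -/
def piecewiseSmoothPaths (n : ℕ) (M : Type*) [TopologicalSpace M]
    [ChartedSpace (EuclideanSpace ℝ (Fin n)) M] : Set (ACPath n M) :=
  {σ | IsPiecewiseSmooth n (extend σ.1)}

end VariationalMetric

end

namespace VariationalMetric

/-! By compactness, `[0, 1]` splits into finitely many intervals, each mapped by `γ` into one chart
domain, so the problem becomes local. In a chart `γ` is an absolutely continuous curve `c` whose
derivative is in `L¹`. Approximating each coordinate of `c'` in `L¹` by a smooth function,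
integrating, and adding a small affine correction gives a smooth `h`, uniformly close to `c`, with
`h'` close to `c'` in `L¹` and the same end points (`exists_contDiff_approx`).

The metric read in the chart is a seminorm in the vector, jointly continuous in point and vector
(`continuousOn_chartNorm`). On compact sets it is bounded by a multiple of the Euclidean norm and
varies uniformly with the base point, so the speeds of `h` and `c` are `L¹`-close; straight segments
in the chart bound the distance between the curves (`exists_approx_in_chart`). Since end points are
kept, the pieces glue (`HasPiecewiseSmoothApprox.append`).

For the inclusion, a piecewise smooth path read in a chart is Lipschitz on compact intervals. -/

/-! ### Smooth approximation of real functions. -/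

theorem _root_.AbsolutelyContinuousOnInterval.lipschitzWith_comp {X Y : Type*} [PseudoMetricSpace X]
    [PseudoMetricSpace Y] {f : ℝ → X} {a b : ℝ} {φ : X → Y} (hφ : LipschitzWith 1 φ)
    (hf : AbsolutelyContinuousOnInterval f a b) :
    AbsolutelyContinuousOnInterval (φ ∘ f) a b := by
  refine squeeze_zero (fun t ↦ Finset.sum_nonneg fun i _ ↦ dist_nonneg) (fun t ↦ ?_) hf
  refine Finset.sum_le_sum fun i _ ↦ ?_
  simpa using hφ.dist_le_mul (f (t.2 i).1) (f (t.2 i).2)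

/-- An absolutely continuous real function is approximated by smooth ones with the same values
at the end points, uniformly and with derivatives close in `L¹`. -/
theorem exists_contDiff_approx_real {f : ℝ → ℝ} {a b : ℝ} (hab : a < b)
    (hf : AbsolutelyContinuousOnInterval f a b) {ε : ℝ} (hε : 0 < ε) :
    ∃ h : ℝ → ℝ, ContDiff ℝ ∞ h ∧ h a = f a ∧ h b = f b ∧ (∀ t ∈ Icc a b, |h t - f t| ≤ ε) ∧
      ∫ t in a..b, |deriv h t - deriv f t| ≤ ε := by
  have hint := hf.intervalIntegrable_deriv
  have hmem : MemLp (deriv f) 1 (volume.restrict (Ioc a b)) := by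
    rw [memLp_one_iff_integrable]
    exact (intervalIntegrable_iff_integrableOn_Ioc_of_le hab.le).1 hint
  obtain ⟨p, -, hp, hpε⟩ := hmem.exist_eLpNorm_sub_le ENNReal.one_ne_top le_rfl (half_pos hε)
  have hpint (c d : ℝ) : IntervalIntegrable p volume c d := hp.continuous.intervalIntegrable _ _
  have hsub : IntervalIntegrable (fun t ↦ p t - deriv f t) volume a b := (hpint a b).sub hint
  have hpI : ∫ t in a..b, |p t - deriv f t| ≤ ε / 2 := by
    rw [intervalIntegral.integral_of_le hab.le]
    have h1 := ofReal_integral_norm_eq_lintegral_enorm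
      ((intervalIntegrable_iff_integrableOn_Ioc_of_le hab.le).1 hsub)
    rw [eLpNorm_sub_comm, eLpNorm_one_eq_lintegral_enorm] at hpε
    have h2 : ENNReal.ofReal (∫ t in Ioc a b, |p t - deriv f t|) ≤ ENNReal.ofReal (ε / 2) :=
      h1.trans_le hpε
    exact (ENNReal.ofReal_le_ofReal_iff (by positivity)).1 h2
  -- The defect at `b` of the primitive of `p`. It is at most the `L¹` error, and is spread linearly
  -- over `[a, b]` in `h` below.
  set κ := f b - f a - ∫ t in a..b, p t with hκ
  have hκ' : |κ| ≤ ε / 2 := by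
    rw [hκ, ← hf.integral_deriv_eq_sub, ← intervalIntegral.integral_sub hint (hpint a b), abs_le]
    have := intervalIntegral.abs_integral_le_integral_abs (μ := volume)
      (f := fun t ↦ deriv f t - p t) hab.le
    simp_rw [abs_sub_comm (deriv f _)] at this
    exact abs_le.1 (this.trans hpI)
  have hba : 0 < b - a := sub_pos.2 hab
  set h : ℝ → ℝ := fun t ↦ f a + (∫ s in a..t, p s) + (t - a) / (b - a) * κ with hh
  have hder (t : ℝ) : HasDerivAt h (p t + κ / (b - a)) t := by
    have h1 := intervalIntegral.integral_hasDerivAt_right (hpint a t)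
      hp.continuous.stronglyMeasurable.stronglyMeasurableAtFilter hp.continuous.continuousAt
    have h2 := ((h1.const_add (f a)).add
      ((((hasDerivAt_id t).sub_const a).div_const (b - a)).mul_const κ))
    convert! h2 using 1
    ring
  have hderiv : deriv h = fun t ↦ p t + κ / (b - a) := funext fun t ↦ (hder t).deriv
  refine ⟨h, ?_, by simp [hh], ?_, ?_, ?_⟩
  · rw [contDiff_infty_iff_deriv, hderiv]
    exact ⟨fun t ↦ (hder t).differentiableAt, hp.add contDiff_const⟩
  · simp only [hh]
    rw [div_self hba.ne', hκ]
    ring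
  · intro t ht
    have hsubset : uIcc a t ⊆ uIcc a b := by
      rw [uIcc_of_le ht.1, uIcc_of_le hab.le]
      exact Icc_subset_Icc_right ht.2
    have e : h t - f t = (∫ s in a..t, (p s - deriv f s)) + (t - a) / (b - a) * κ := by
      rw [intervalIntegral.integral_sub (hpint a t) (hint.mono_set hsubset),
        (hf.mono hsubset).integral_deriv_eq_sub]
      simp only [hh]
      ring
    have h1 : |∫ s in a..t, (p s - deriv f s)| ≤ ε / 2 := by
      refine (intervalIntegral.abs_integral_le_integral_abs ht.1).trans (le_trans ?_ hpI)
      refine intervalIntegral.integral_mono_interval le_rfl ht.1 ht.2 ?_ hsub.abs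
      exact Filter.Eventually.of_forall fun x ↦ abs_nonneg _
    have h2 : |(t - a) / (b - a) * κ| ≤ ε / 2 := by
      rw [abs_mul]
      refine (mul_le_of_le_one_left (abs_nonneg _) ?_).trans hκ'
      rw [abs_of_nonneg (div_nonneg (sub_nonneg.2 ht.1) hba.le)]
      exact (div_le_one hba).2 (by linarith [ht.2])
    rw [e]
    exact (abs_add_le _ _).trans (by linarith)
  · have h1 : ∫ t in a..b, |deriv h t - deriv f t| ≤
        ∫ t in a..b, (|p t - deriv f t| + |κ| / (b - a)) := by
      refine intervalIntegral.integral_mono_on hab.le ?_ ?_ fun t _ ↦ ?_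
      · rw [hderiv]
        exact (((hpint a b).add intervalIntegrable_const).sub hint).abs
      · exact hsub.abs.add intervalIntegrable_const
      · rw [hderiv]
        have : |κ| / (b - a) = |κ / (b - a)| := by rw [abs_div, abs_of_pos hba]
        rw [this]
        refine le_trans (le_of_eq ?_) (abs_add_le _ _)
        congr 1
        ring
    rw [intervalIntegral.integral_add hsub.abs intervalIntegrable_const,
      intervalIntegral.integral_const, smul_eq_mul, mul_div_cancel₀ _ hba.ne'] at h1
    linarith

/-! ### Smooth approximation of curves in Euclidean space, coordinate by coordinate. -/

section Euclidean

variable {n : ℕ} {c : ℝ → EuclideanSpace ℝ (Fin n)} {a b : ℝ}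

theorem _root_.LipschitzWith.euclidean_apply (j : Fin n) :
    LipschitzWith 1 fun x : EuclideanSpace ℝ (Fin n) ↦ x j :=
  LipschitzWith.of_dist_le_mul fun x y ↦ by
    rw [dist_eq_norm, dist_eq_norm, NNReal.coe_one, one_mul]
    exact PiLp.norm_apply_le (x - y) j

theorem _root_.AbsolutelyContinuousOnInterval.euclidean_apply
    (hc : AbsolutelyContinuousOnInterval c a b) (j : Fin n) :
    AbsolutelyContinuousOnInterval (fun t ↦ c t j) a b :=
  hc.lipschitzWith_comp (LipschitzWith.euclidean_apply j)

/-- Differentiability matters: otherwise `deriv c t` is `0` by default, while a single coordinate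
may still have a nonzero derivative. -/
theorem deriv_euclidean_apply {t : ℝ} (h : DifferentiableAt ℝ c t) (j : Fin n) :
    deriv c t j = deriv (fun t ↦ c t j) t :=
  (((EuclideanSpace.proj (𝕜 := ℝ) j).hasFDerivAt.comp_hasDerivAt t h.hasDerivAt).deriv).symm

theorem _root_.AbsolutelyContinuousOnInterval.ae_differentiableAt_euclidean
    (hc : AbsolutelyContinuousOnInterval c a b) :
    ∀ᵐ t, t ∈ uIcc a b → DifferentiableAt ℝ c t := by
  have h := ae_all_iff.2 fun j ↦ (hc.euclidean_apply j).ae_differentiableAt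
  filter_upwards [h] with t ht hmem
  exact differentiableAt_euclidean.2 fun j ↦ ht j hmem

theorem norm_le_sum_abs (x : EuclideanSpace ℝ (Fin n)) : ‖x‖ ≤ ∑ j, |x j| := by
  have h : x = ∑ j, EuclideanSpace.single j (x j) := by
    ext i
    simp [Finset.sum_apply, Pi.single_apply]
  conv_lhs => rw [h]
  refine (norm_sum_le _ _).trans (Finset.sum_le_sum fun j _ ↦ ?_)
  simp

theorem _root_.AbsolutelyContinuousOnInterval.integrableOn_deriv_euclidean (hab : a ≤ b)
    (hc : AbsolutelyContinuousOnInterval c a b) : IntegrableOn (deriv c) (Icc a b) := by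
  have hj (j : Fin n) : IntegrableOn (fun t ↦ deriv c t j) (Icc a b) := by
    have h := (hc.euclidean_apply j).intervalIntegrable_deriv
    rw [intervalIntegrable_iff_integrableOn_Icc_of_le hab] at h
    refine h.congr_fun_ae ?_
    rw [Filter.EventuallyEq, ae_restrict_iff' measurableSet_Icc, ← uIcc_of_le hab]
    filter_upwards [hc.ae_differentiableAt_euclidean] with t ht hmem
    exact (deriv_euclidean_apply (ht hmem) j).symm
  have h2 : IntegrableOn (fun t ↦ (WithLp.toLp 2 fun j ↦ deriv c t j : EuclideanSpace ℝ (Fin n)))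
      (Icc a b) :=
    (PiLp.continuousLinearEquiv 2 ℝ fun _ : Fin n ↦ ℝ).symm.toContinuousLinearMap.integrable_comp
      (Integrable.of_eval hj)
  exact h2

/-- An absolutely continuous curve in Euclidean space is approximated by smooth ones with the same
values at the end points, uniformly and with derivatives close in `L¹`. -/
theorem exists_contDiff_approx (hab : a < b) (hc : AbsolutelyContinuousOnInterval c a b)
    {ε : ℝ} (hε : 0 < ε) :
    ∃ h : ℝ → EuclideanSpace ℝ (Fin n), ContDiff ℝ ∞ h ∧ h a = c a ∧ h b = c b ∧
      (∀ t ∈ Icc a b, ‖h t - c t‖ ≤ ε) ∧ ∫ t in Icc a b, ‖deriv h t - deriv c t‖ ≤ ε := by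
  -- The `n` coordinate errors add up; `n + 1` keeps the denominator positive when `n = 0`.
  have hδ : 0 < ε / (n + 1) := by positivity
  have hn : ∑ _j : Fin n, ε / (n + 1) ≤ ε := by
    rw [Finset.sum_const, Finset.card_univ, Fintype.card_fin, nsmul_eq_mul, mul_div_assoc',
      div_le_iff₀ (by positivity)]
    nlinarith
  choose h hsm ha hb hsup hint using fun j ↦
    exists_contDiff_approx_real hab (hc.euclidean_apply j) hδ
  set H : ℝ → EuclideanSpace ℝ (Fin n) := fun t ↦ WithLp.toLp 2 fun j ↦ h j t with hH
  have hHs : ContDiff ℝ ∞ H := contDiff_euclidean.2 hsm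
  have hder (j : Fin n) : IntervalIntegrable (fun t ↦ deriv (h j) t - deriv (fun t ↦ c t j) t)
      volume a b :=
    (((hsm j).continuous_deriv (by simp)).intervalIntegrable _ _).sub
      (hc.euclidean_apply j).intervalIntegrable_deriv
  refine ⟨H, hHs, ?_, ?_, fun t ht ↦ ?_, ?_⟩
  · ext j; exact ha j
  · ext j; exact hb j
  · exact (norm_le_sum_abs _).trans ((Finset.sum_le_sum fun j _ ↦ hsup j t ht).trans hn)
  · calc ∫ t in Icc a b, ‖deriv H t - deriv c t‖
        ≤ ∫ t in Icc a b, ∑ j, |deriv (h j) t - deriv (fun t ↦ c t j) t| := by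
          refine integral_mono_ae ?_ ?_ ?_
          · exact (((hHs.continuous_deriv (by simp)).integrableOn_Icc).sub
              (hc.integrableOn_deriv_euclidean hab.le)).norm
          · exact integrable_finsetSum _ fun j _ ↦
              ((intervalIntegrable_iff_integrableOn_Icc_of_le hab.le).1 (hder j).abs)
          · rw [Filter.EventuallyLE, ae_restrict_iff' measurableSet_Icc, ← uIcc_of_le hab.le]
            filter_upwards [hc.ae_differentiableAt_euclidean] with t ht hmem
            refine (norm_le_sum_abs _).trans (Finset.sum_le_sum fun j _ ↦ le_of_eq ?_)
            rw [PiLp.sub_apply, deriv_euclidean_apply (ht hmem),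
              deriv_euclidean_apply (hHs.differentiable (by simp) t)]
      _ = ∑ j, ∫ t in a..b, |deriv (h j) t - deriv (fun t ↦ c t j) t| := by
          rw [integral_finsetSum _ fun j _ ↦
            ((intervalIntegrable_iff_integrableOn_Icc_of_le hab.le).1 (hder j).abs)]
          refine Finset.sum_congr rfl fun j _ ↦ ?_
          rw [intervalIntegral.integral_of_le hab.le, integral_Icc_eq_integral_Ioc]
      _ ≤ ε := (Finset.sum_le_sum fun j _ ↦ hint j).trans hn

end Euclidean


/-! ### The metric in a chart, and local approximation. -/

section Chart

variable {n : ℕ} {M : Type*} [TopologicalSpace M]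
  [ChartedSpace (EuclideanSpace ℝ (Fin n)) M] [IsManifold (𝓡 n) ∞ M]

theorem tangentNorm_smul (g : ContRiemannianMetric n M) (p : M) (r : ℝ)
    (v : TangentSpace (𝓡 n) p) : tangentNorm g p (r • v) = |r| * tangentNorm g p v := by
  unfold tangentNorm
  rw [map_smul, map_smul, smul_apply, smul_eq_mul, smul_eq_mul, ← mul_assoc,
    Real.sqrt_mul (mul_self_nonneg r), Real.sqrt_mul_self_eq_abs]

theorem tangentNorm_add_le (g : ContRiemannianMetric n M) (p : M)
    (v w : TangentSpace (𝓡 n) p) :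
    tangentNorm g p (v + w) ≤ tangentNorm g p v + tangentNorm g p w := by
  let : RiemannianBundle (fun x : M ↦ TangentSpace (𝓡 n) x) := ⟨g.toRiemannianMetric⟩
  have h (v : TangentSpace (𝓡 n) p) : tangentNorm g p v = ‖v‖ :=
    (norm_eq_sqrt_real_inner v).symm
  rw [h, h, h]
  exact norm_add_le v w

theorem tangentNorm_nonneg (g : ContRiemannianMetric n M) (p : M)
    (v : TangentSpace (𝓡 n) p) : 0 ≤ tangentNorm g p v := Real.sqrt_nonneg _

/-- The norm of the tangent vector with coordinates `v` at the point with coordinates `x`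
in the chart `u`. -/
noncomputable def chartNorm (g : ContRiemannianMetric n M)
    (u : OpenPartialHomeomorph M (EuclideanSpace ℝ (Fin n))) (x v : EuclideanSpace ℝ (Fin n)) : ℝ :=
  tangentNorm g (u.symm x) (mfderiv (𝓡 n) (𝓡 n) u.symm x v)

variable {g : ContRiemannianMetric n M}
  {u : OpenPartialHomeomorph M (EuclideanSpace ℝ (Fin n))}

theorem chartNorm_nonneg (x v : EuclideanSpace ℝ (Fin n)) : 0 ≤ chartNorm g u x v :=
  tangentNorm_nonneg _ _ _

theorem chartNorm_smul (x : EuclideanSpace ℝ (Fin n)) (r : ℝ) (v : EuclideanSpace ℝ (Fin n)) :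
    chartNorm g u x (r • v) = |r| * chartNorm g u x v := by
  unfold chartNorm
  rw [← tangentNorm_smul]
  congr 1
  exact map_smul (mfderiv (𝓡 n) (𝓡 n) u.symm x) r v

theorem chartNorm_add_le (x v w : EuclideanSpace ℝ (Fin n)) :
    chartNorm g u x (v + w) ≤ chartNorm g u x v + chartNorm g u x w := by
  unfold chartNorm
  refine le_of_eq_of_le ?_ (tangentNorm_add_le _ _ _ _)
  congr 1
  exact map_add (mfderiv (𝓡 n) (𝓡 n) u.symm x) v w

theorem abs_chartNorm_sub_le (x v w : EuclideanSpace ℝ (Fin n)) :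
    |chartNorm g u x v - chartNorm g u x w| ≤ chartNorm g u x (v - w) := by
  have h1 := chartNorm_add_le (g := g) (u := u) x (v - w) w
  have h2 := chartNorm_add_le (g := g) (u := u) x (w - v) v
  have h3 := chartNorm_smul (g := g) (u := u) x (-1) (v - w)
  rw [sub_add_cancel] at h1 h2
  rw [neg_smul, one_smul, neg_sub, abs_neg, abs_one, one_mul] at h3
  exact abs_le.2 ⟨by linarith, by linarith⟩

/-- The tangent map of the smooth `u.symm` is continuous into the tangent bundle, where the inner
product is continuous. -/
theorem continuousOn_chartNorm (hu : u ∈ IsManifold.maximalAtlas (𝓡 n) ∞ M) :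
    ContinuousOn (fun z : EuclideanSpace ℝ (Fin n) × EuclideanSpace ℝ (Fin n) ↦
      chartNorm g u z.1 z.2) (u.target ×ˢ univ) := by
  have h1 := (contMDiffOn_symm_of_mem_maximalAtlas hu).continuousOn_tangentMapWithin
    (by simp) u.open_target.uniqueMDiffOn
  have h2 : ContinuousOn (fun z : EuclideanSpace ℝ (Fin n) × EuclideanSpace ℝ (Fin n) ↦
      (⟨u.symm z.1, mfderiv (𝓡 n) (𝓡 n) u.symm z.1 z.2⟩ : TangentBundle (𝓡 n) M))
      (u.target ×ˢ univ) := by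
    have h3 := h1.comp (tangentBundleModelSpaceHomeomorph (𝓡 n)).symm.continuous.continuousOn
      (s := u.target ×ˢ univ) (fun z hz ↦ hz.1)
    refine h3.congr fun z hz ↦ ?_
    simp only [Function.comp, tangentMapWithin, tangentBundleModelSpaceHomeomorph_coe_symm,
      TotalSpace.toProd, Equiv.coe_fn_symm_mk]
    rw [mfderivWithin_of_isOpen u.open_target hz.1]
    rfl
  let : RiemannianBundle (fun x : M ↦ TangentSpace (𝓡 n) x) := ⟨g.toRiemannianMetric⟩
  exact (h2.inner_bundle h2).sqrt

/-- Continuity bounds the norm on the compact product of `K` with the unit ball; homogeneity extends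
the bound to all `v`. -/
theorem exists_chartNorm_le (hu : u ∈ IsManifold.maximalAtlas (𝓡 n) ∞ M)
    {K : Set (EuclideanSpace ℝ (Fin n))} (hK : IsCompact K) (hKu : K ⊆ u.target) :
    ∃ C : ℝ, 0 ≤ C ∧ ∀ x ∈ K, ∀ v, chartNorm g u x v ≤ C * ‖v‖ := by
  obtain ⟨C, hC⟩ := (hK.prod (isCompact_closedBall (0 : EuclideanSpace ℝ (Fin n)) 1)
    ).exists_bound_of_continuousOn
    ((continuousOn_chartNorm (g := g) hu).mono (prod_mono hKu (subset_univ _)))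
  refine ⟨max C 0, le_max_right _ _, fun x hx v ↦ ?_⟩
  rcases eq_or_ne v 0 with rfl | hv
  · have := chartNorm_smul (g := g) (u := u) x 0 0
    simp_all
  · have hv' : 0 < ‖v‖ := norm_pos_iff.2 hv
    have h1 := hC (x, ‖v‖⁻¹ • v) ⟨hx, by simp [norm_smul, hv'.ne']⟩
    rw [chartNorm_smul, abs_of_pos (inv_pos.2 hv'), Real.norm_of_nonneg
      (mul_nonneg (inv_nonneg.2 hv'.le) (chartNorm_nonneg _ _)), inv_mul_le_iff₀ hv',
      mul_comm] at h1
    exact h1.trans (by gcongr; exact le_max_left _ _)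

/-- Uniform continuity on `K` times the unit ball, then rescaling of `v`. -/
theorem exists_abs_chartNorm_sub_le (hu : u ∈ IsManifold.maximalAtlas (𝓡 n) ∞ M)
    {K : Set (EuclideanSpace ℝ (Fin n))} (hK : IsCompact K) (hKu : K ⊆ u.target)
    {η : ℝ} (hη : 0 < η) :
    ∃ δ > 0, ∀ x ∈ K, ∀ y ∈ K, dist x y < δ → ∀ v,
      |chartNorm g u x v - chartNorm g u y v| ≤ η * ‖v‖ := by
  have huc := (hK.prod (isCompact_closedBall (0 : EuclideanSpace ℝ (Fin n)) 1)
    ).uniformContinuousOn_of_continuous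
    ((continuousOn_chartNorm (g := g) hu).mono (prod_mono hKu (subset_univ _)))
  obtain ⟨δ, hδ, h⟩ := Metric.uniformContinuousOn_iff.1 huc η hη
  refine ⟨δ, hδ, fun x hx y hy hxy v ↦ ?_⟩
  rcases eq_or_ne v 0 with rfl | hv
  · have h1 := chartNorm_smul (g := g) (u := u) x 0 0
    have h2 := chartNorm_smul (g := g) (u := u) y 0 0
    simp_all
  · have hv' : 0 < ‖v‖ := norm_pos_iff.2 hv
    have hm : ‖v‖⁻¹ • v ∈ Metric.closedBall (0 : EuclideanSpace ℝ (Fin n)) 1 := by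
      simp [norm_smul, hv'.ne']
    have h1 := (h (x, ‖v‖⁻¹ • v) ⟨hx, hm⟩ (y, ‖v‖⁻¹ • v) ⟨hy, hm⟩ (by simpa [Prod.dist_eq, hδ])).le
    rw [Real.dist_eq, chartNorm_smul, chartNorm_smul, ← mul_sub, abs_mul, abs_abs,
      abs_of_pos (inv_pos.2 hv'), inv_mul_le_iff₀ hv', mul_comm] at h1
    exact h1

theorem speed_congr {γ σ : ℝ → M} {t : ℝ} (h : γ =ᶠ[𝓝 t] σ) : speed g γ t = speed g σ t := by
  -- The two velocities live in tangent spaces at different expressions for the point; viewing both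
  -- in the model space avoids a transport.
  have key (p q : M) (hpq : p = q) (v w : EuclideanSpace ℝ (Fin n)) (hvw : v = w) :
      tangentNorm g p v = tangentNorm g q w := by
    subst hpq hvw
    rfl
  refine key _ _ h.eq_of_nhds _ _ ?_
  exact congrArg (fun L : ℝ →L[ℝ] EuclideanSpace ℝ (Fin n) ↦ L 1)
    (h.mfderiv_eq (I := 𝓘(ℝ, ℝ)) (I' := 𝓡 n))

theorem speed_eq_chartNorm (hu : u ∈ IsManifold.maximalAtlas (𝓡 n) ∞ M) {σ : ℝ → M}
    {c : ℝ → EuclideanSpace ℝ (Fin n)} {t : ℝ} (hc : DifferentiableAt ℝ c t)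
    (hct : c t ∈ u.target) (hσ : σ =ᶠ[𝓝 t] u.symm ∘ c) :
    speed g σ t = chartNorm g u (c t) (deriv c t) := by
  rw [speed_congr hσ]
  have h1 : MDifferentiableAt (𝓡 n) (𝓡 n) u.symm (c t) :=
    ((contMDiffOn_symm_of_mem_maximalAtlas hu).contMDiffAt
      (u.open_target.mem_nhds hct)).mdifferentiableAt (by simp)
  unfold speed chartNorm
  rw [mfderiv_comp t h1 hc.mdifferentiableAt, mfderiv_eq_fderiv]
  rfl

omit [IsManifold (𝓡 n) ∞ M] in
theorem contMDiffOn_symm_comp (hu : u ∈ IsManifold.maximalAtlas (𝓡 n) ∞ M)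
    {c : ℝ → EuclideanSpace ℝ (Fin n)} {s : Set ℝ} (hc : ContDiff ℝ ∞ c)
    (hcs : MapsTo c s u.target) : ContMDiffOn 𝓘(ℝ, ℝ) (𝓡 n) ∞ (u.symm ∘ c) s :=
  (contMDiffOn_symm_of_mem_maximalAtlas hu).comp hc.contMDiff.contMDiffOn hcs

/-- The image under `u.symm` of the straight segment is an admissible path, and its coordinate
velocity is the constant `y - x`. -/
theorem rDist_symm_le (hu : u ∈ IsManifold.maximalAtlas (𝓡 n) ∞ M)
    {x y : EuclideanSpace ℝ (Fin n)} (hxy : segment ℝ x y ⊆ u.target) {C : ℝ}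
    (hC : ∀ z ∈ segment ℝ x y, ∀ v, chartNorm g u z v ≤ C * ‖v‖) :
    rDist g (u.symm x) (u.symm y) ≤ ENNReal.ofReal (C * ‖y - x‖) := by
  set c : ℝ → EuclideanSpace ℝ (Fin n) := fun t ↦ x + t • (y - x) with hc
  have hcd : ContDiff ℝ ∞ c := by fun_prop
  have hseg : MapsTo c (Icc 0 1) (segment ℝ x y) := by
    rw [segment_eq_image']
    exact fun t ht ↦ ⟨t, ht, rfl⟩
  have hderiv (t : ℝ) : deriv c t = y - x := by
    have h := (((hasDerivAt_id t).smul_const (y - x)).const_add x).deriv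
    rwa [one_smul] at h
  have hsm := contMDiffOn_symm_comp hu hcd (hseg.mono_right hxy)
  have hps : IsPiecewiseSmooth n (u.symm ∘ c) := by
    refine ⟨hsm.continuousOn, 1, fun i ↦ (i : ℝ), by simp, by simp, by simp, fun i hi ↦ ?_⟩
    obtain rfl : i = 0 := by omega
    simpa using hsm
  refine (iInf₂_le (u.symm ∘ c) ⟨hps, by simp [hc], by simp [hc]⟩).trans ?_
  calc ∫⁻ t in Icc (0 : ℝ) 1, ENNReal.ofReal (speed g (u.symm ∘ c) t)
      ≤ ∫⁻ t in Icc (0 : ℝ) 1, ENNReal.ofReal (C * ‖y - x‖) := by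
        refine setLIntegral_mono' measurableSet_Icc fun t ht ↦ ENNReal.ofReal_le_ofReal ?_
        rw [speed_eq_chartNorm hu (hcd.differentiable (by simp) t) (hxy (hseg ht))
          Filter.EventuallyEq.rfl, hderiv]
        exact hC _ (hseg ht) _
    _ = ENNReal.ofReal (C * ‖y - x‖) := by simp

/-- In a chart, an absolutely continuous curve is approximated by smooth curves with the same
end points. -/
theorem exists_approx_in_chart (hu : u ∈ IsManifold.maximalAtlas (𝓡 n) ∞ M) {γ : ℝ → M}
    {a b : ℝ} (hab : a < b) (hγ : ContinuousOn γ (Icc a b)) (hγu : MapsTo γ (Icc a b) u.source)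
    (hac : AbsolutelyContinuousOnInterval (u ∘ γ) a b) {ε : ℝ} (hε : 0 < ε) :
    ∃ σ : ℝ → M, ContMDiffOn 𝓘(ℝ, ℝ) (𝓡 n) ∞ σ (Icc a b) ∧ σ a = γ a ∧ σ b = γ b ∧
      (∀ t ∈ Icc a b, rDist g (γ t) (σ t) ≤ ENNReal.ofReal ε) ∧
      ∫⁻ t in Icc a b, ENNReal.ofReal |speed g γ t - speed g σ t| ≤ ENNReal.ofReal ε := by
  set c := u ∘ γ with hc
  have hcont : ContinuousOn c (Icc a b) := u.continuousOn.comp hγ hγu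
  have hK : IsCompact (c '' Icc a b) := isCompact_Icc.image_of_continuousOn hcont
  have hKu : c '' Icc a b ⊆ u.target := by
    rintro _ ⟨t, ht, rfl⟩
    exact u.map_source (hγu ht)
  obtain ⟨r, hr, hrK⟩ := hK.exists_cthickening_subset_open u.open_target hKu
  have hK' : IsCompact (Metric.cthickening r (c '' Icc a b)) := hK.cthickening
  have hball {t : ℝ} (ht : t ∈ Icc a b) :
      Metric.closedBall (c t) r ⊆ Metric.cthickening r (c '' Icc a b) :=
    Metric.closedBall_subset_cthickening (mem_image_of_mem c ht) r
  obtain ⟨C, hC0, hC⟩ := exists_chartNorm_le (g := g) hu hK' hrK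
  have hcint := hac.integrableOn_deriv_euclidean hab.le
  set A := ∫ t in Icc a b, ‖deriv c t‖ with hA
  have hA0 : 0 ≤ A := integral_nonneg fun t ↦ norm_nonneg _
  -- Moving the base point costs at most this factor times `A`, hence at most `ε / 2`; `A + 1`
  -- avoids division by zero.
  obtain ⟨δ, hδ, hω⟩ := exists_abs_chartNorm_sub_le (g := g) hu hK' hrK
    (η := ε / 2 / (A + 1)) (by positivity)
  -- `r` keeps `h` in the compact neighbourhood, `δ / 2` activates `hω`, and the last term makes `C
  -- * η ≤ ε / 2`.
  set η := min (min r (δ / 2)) (ε / 2 / (C + 1)) with hη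
  have hη0 : 0 < η := by positivity
  have hηr : η ≤ r := (min_le_left _ _).trans (min_le_left _ _)
  have hηδ : η < δ := ((min_le_left _ _).trans (min_le_right _ _)).trans_lt (half_lt_self hδ)
  have hηC : C * η ≤ ε / 2 := by
    have h1 : η * (C + 1) ≤ ε / 2 := (le_div_iff₀ (by positivity)).1 (min_le_right _ _)
    nlinarith
  obtain ⟨h, hsm, ha, hb, hsup, hint⟩ := exists_contDiff_approx hab hac hη0
  have hmem {t : ℝ} (ht : t ∈ Icc a b) : h t ∈ Metric.closedBall (c t) r :=
    mem_closedBall_iff_norm.2 ((hsup t ht).trans hηr)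
  have hmemt {t : ℝ} (ht : t ∈ Icc a b) : h t ∈ u.target := hrK (hball ht (hmem ht))
  have hleft {t : ℝ} (ht : t ∈ Icc a b) : u.symm (c t) = γ t := u.left_inv (hγu ht)
  refine ⟨u.symm ∘ h, contMDiffOn_symm_comp hu hsm fun t ht ↦ hmemt ht, ?_, ?_, ?_, ?_⟩
  · rw [Function.comp_apply, ha, hleft (left_mem_Icc.2 hab.le)]
  · rw [Function.comp_apply, hb, hleft (right_mem_Icc.2 hab.le)]
  · intro t ht
    have hseg : segment ℝ (c t) (h t) ⊆ Metric.cthickening r (c '' Icc a b) :=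
      ((convex_closedBall (c t) r).segment_subset (Metric.mem_closedBall_self hr.le)
        (hmem ht)).trans (hball ht)
    rw [← hleft ht]
    refine (rDist_symm_le hu (hseg.trans hrK) fun z hz v ↦ hC z (hseg hz) v).trans
      (ENNReal.ofReal_le_ofReal ?_)
    have := mul_le_mul_of_nonneg_left (hsup t ht) hC0
    linarith
  · have hhint : IntegrableOn (deriv h) (Icc a b) :=
      (hsm.continuous_deriv (by simp)).integrableOn_Icc
    have hdint : IntegrableOn (fun t ↦ ‖deriv h t - deriv c t‖) (Icc a b) :=
      (hhint.sub hcint).norm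
    calc ∫⁻ t in Icc a b, ENNReal.ofReal |speed g γ t - speed g (u.symm ∘ h) t|
        ≤ ∫⁻ t in Icc a b, ENNReal.ofReal
            (ε / 2 / (A + 1) * ‖deriv c t‖ + C * ‖deriv h t - deriv c t‖) := by
          -- Speeds use two-sided derivatives, and `γ` is controlled only on `[a, b]`; the end
          -- points form a null set.
          rw [Measure.restrict_congr_set Ioo_ae_eq_Icc.symm]
          refine lintegral_mono_ae ?_
          rw [ae_restrict_iff' measurableSet_Ioo]
          filter_upwards [hac.ae_differentiableAt_euclidean] with t hdiff ht
          have htI := Ioo_subset_Icc_self ht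
          rw [uIcc_of_le hab.le] at hdiff
          have hγσ : γ =ᶠ[𝓝 t] u.symm ∘ c := by
            filter_upwards [Ioo_mem_nhds ht.1 ht.2] with s hs
            exact (hleft (Ioo_subset_Icc_self hs)).symm
          rw [speed_eq_chartNorm hu (hdiff htI) (hKu (mem_image_of_mem c htI)) hγσ,
            speed_eq_chartNorm hu (hsm.differentiable (by simp) t) (hmemt htI)
              Filter.EventuallyEq.rfl]
          refine ENNReal.ofReal_le_ofReal ?_
          have h1 := hω (c t) (hball htI (Metric.mem_closedBall_self hr.le)) (h t)
            (hball htI (hmem htI))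
            (by rw [dist_comm, dist_eq_norm]; exact (hsup t htI).trans_lt hηδ) (deriv c t)
          have h2 := abs_chartNorm_sub_le (g := g) (u := u) (h t) (deriv h t) (deriv c t)
          have h3 := hC (h t) (hball htI (hmem htI)) (deriv h t - deriv c t)
          rw [abs_sub_comm] at h2
          -- The intermediate term changes first the base point, then the vector.
          exact (abs_sub_le _ (chartNorm g u (h t) (deriv c t)) _).trans
            (add_le_add h1 (h2.trans h3))
      _ = ENNReal.ofReal (∫ t in Icc a b,
            (ε / 2 / (A + 1) * ‖deriv c t‖ + C * ‖deriv h t - deriv c t‖)) := by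
          refine (ofReal_integral_eq_lintegral_ofReal ?_ ?_).symm
          · exact (hcint.norm.const_mul _).add (hdint.const_mul _)
          · exact Filter.Eventually.of_forall fun t ↦ by positivity
      _ ≤ ENNReal.ofReal ε := by
          refine ENNReal.ofReal_le_ofReal ?_
          rw [integral_add (hcint.norm.const_mul _) (hdint.const_mul _), integral_const_mul,
            integral_const_mul, ← hA]
          have h1 : ε / 2 / (A + 1) * A ≤ ε / 2 := by
            rw [div_mul_eq_mul_div, div_le_iff₀ (by positivity)]
            nlinarith
          have h2 := mul_le_mul_of_nonneg_left hint hC0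
          linarith

end Chart


/-! ### Piecewise smooth paths are absolutely continuous. -/

theorem _root_.LipschitzOnWith.of_inter_Iic_of_inter_Ici {X : Type*} [PseudoMetricSpace X]
    {f : ℝ → X} {s : Set ℝ} (hs : s.OrdConnected) {c : ℝ} {K L : NNReal}
    (h₁ : LipschitzOnWith K f (s ∩ Iic c)) (h₂ : LipschitzOnWith L f (s ∩ Ici c)) :
    LipschitzOnWith (max K L) f s := by
  have hK : (K : ℝ) ≤ (max K L : NNReal) := NNReal.coe_le_coe.2 (le_max_left _ _)
  have hL : (L : ℝ) ≤ (max K L : NNReal) := NNReal.coe_le_coe.2 (le_max_right _ _)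
  have key : ∀ x ∈ s, ∀ y ∈ s, x ≤ y → dist (f x) (f y) ≤ (max K L : NNReal) * dist x y := by
    intro x hx y hy hxy
    rcases le_total y c with hyc | hcy
    · exact (h₁.dist_le_mul x ⟨hx, hxy.trans hyc⟩ y ⟨hy, hyc⟩).trans (by gcongr)
    rcases le_total c x with hcx | hxc
    · exact (h₂.dist_le_mul x ⟨hx, hcx⟩ y ⟨hy, hcy⟩).trans (by gcongr)
    have hc : c ∈ s := hs.out hx hy ⟨hxc, hcy⟩
    have h3 := h₁.dist_le_mul x ⟨hx, hxc⟩ c ⟨hc, self_mem_Iic⟩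
    have h4 := h₂.dist_le_mul c ⟨hc, self_mem_Ici⟩ y ⟨hy, hcy⟩
    have h5 : dist x y = dist x c + dist c y := by
      rw [Real.dist_eq, Real.dist_eq, Real.dist_eq, abs_of_nonpos (by linarith),
        abs_of_nonpos (by linarith), abs_of_nonpos (by linarith)]
      ring
    rw [h5, mul_add]
    exact (dist_triangle _ (f c) _).trans (add_le_add (h3.trans (by gcongr)) (h4.trans (by gcongr)))
  refine LipschitzOnWith.of_dist_le_mul fun x hx y hy ↦ ?_
  rcases le_total x y with h | h
  · exact key x hx y hy h
  · rw [dist_comm, dist_comm x]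
    exact key y hy x hx h

variable {n : ℕ} {M : Type*} [TopologicalSpace M]
  [ChartedSpace (EuclideanSpace ℝ (Fin n)) M]

theorem IsPiecewiseSmooth.isAbsolutelyContinuous {γ : ℝ → M} (hγ : IsPiecewiseSmooth n γ) :
    IsAbsolutelyContinuous n γ := by
  obtain ⟨hcont, N, t, ht0, htN, -, hsm⟩ := hγ
  refine ⟨hcont, fun u hu a b hab hsub ↦ ?_⟩
  -- Induction along the partition: each new piece is a (possibly empty) compact interval on which
  -- `u ∘ γ` is smooth, hence Lipschitz.
  have key : ∀ k ≤ N, ∃ K, LipschitzOnWith K (u ∘ γ) (Icc a b ∩ Iic (t k)) := by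
    intro k
    induction k with
    | zero =>
      refine fun _ ↦ ⟨0, LipschitzOnWith.of_dist_le_mul fun x hx y hy ↦ ?_⟩
      have h0 {z : ℝ} (hz : z ∈ Icc a b ∩ Iic (t 0)) : z = 0 :=
        le_antisymm (hz.2.trans_eq ht0) (hsub hz.1).1.1
      rw [h0 hx, h0 hy]
      simp
    | succ k ih =>
      intro hk
      obtain ⟨K, hK⟩ := ih (by omega)
      set S := Icc a b ∩ Iic (t (k + 1)) ∩ Ici (t k) with hS
      have hSe : S = Icc (max a (t k)) (min b (t (k + 1))) := by
        ext z
        simp only [hS, mem_inter_iff, mem_Icc, mem_Iic, mem_Ici, max_le_iff, le_min_iff]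
        tauto
      have hd : ContDiffOn ℝ ∞ (u ∘ γ) S := by
        rw [← contMDiffOn_iff_contDiffOn]
        exact (contMDiffOn_of_mem_maximalAtlas hu).comp
          ((hsm k (by omega)).mono fun z hz ↦ ⟨hz.2, hz.1.2⟩) fun z hz ↦ (hsub hz.1.1).2
      obtain ⟨L, hL⟩ := hd.exists_lipschitzOnWith (by simp) (hSe ▸ convex_Icc _ _)
        (hSe ▸ isCompact_Icc)
      exact ⟨_, LipschitzOnWith.of_inter_Iic_of_inter_Ici (ordConnected_Icc.inter ordConnected_Iic)
        (hK.mono fun z hz ↦ ⟨hz.1.1, hz.2⟩) hL⟩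
  obtain ⟨K, hK⟩ := key N le_rfl
  refine LipschitzOnWith.absolutelyContinuousOnInterval (K := K) (hK.mono fun z hz ↦ ?_)
  rw [uIcc_of_le hab] at hz
  exact ⟨hz, (hsub hz).1.2.trans_eq htN.symm⟩

/-! ### Gluing the local approximations, and density. -/

variable [IsManifold (𝓡 n) ∞ M]

theorem rDist_self (g : ContRiemannianMetric n M) (p : M) : rDist g p p = 0 := by
  refine le_antisymm ((iInf₂_le (fun _ ↦ p) ⟨⟨continuousOn_const, 1, fun i ↦ (i : ℝ), by simp,
    by simp, by simp, fun i _ ↦ contMDiffOn_const⟩, rfl, rfl⟩).trans ?_) zero_le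
  have h (t : ℝ) : speed g (fun _ ↦ p) t = 0 := by
    have h0 := tangentNorm_smul g p 0 0
    rw [zero_smul, abs_zero, zero_mul] at h0
    unfold speed
    rw [mfderiv_const]
    exact h0
  simp [length, h]

/-- The restriction of `γ` to `[0, b]` is approximated by piecewise smooth curves with the same
end points. -/
def HasPiecewiseSmoothApprox (g : ContRiemannianMetric n M) (γ : ℝ → M) (b : ℝ) : Prop :=
  ∀ ε : ℝ, 0 < ε → ∃ σ : ℝ → M, ContinuousOn σ (Icc 0 b) ∧
    (∃ (N : ℕ) (t : ℕ → ℝ), t 0 = 0 ∧ t N = b ∧ (∀ i < N, t i < t (i + 1)) ∧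
      ∀ i < N, ContMDiffOn 𝓘(ℝ, ℝ) (𝓡 n) ∞ σ (Icc (t i) (t (i + 1)))) ∧ σ b = γ b ∧
    (∀ t ∈ Icc 0 b, rDist g (γ t) (σ t) ≤ ENNReal.ofReal ε) ∧
    ∫⁻ t in Icc 0 b, ENNReal.ofReal |speed g γ t - speed g σ t| ≤ ENNReal.ofReal ε

theorem hasPiecewiseSmoothApprox_zero (g : ContRiemannianMetric n M) (γ : ℝ → M) :
    HasPiecewiseSmoothApprox g γ 0 := by
  refine fun ε hε ↦ ⟨γ, by simp, ⟨0, fun _ ↦ 0, rfl, rfl, by simp, by simp⟩, rfl,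
    fun t _ ↦ by simp [rDist_self], by simp⟩

/-- Both approximants equal `γ b` at `b`, so their concatenation is continuous; matching at `c` lets
the process continue. -/
theorem HasPiecewiseSmoothApprox.append {g : ContRiemannianMetric n M} {γ : ℝ → M} {b c : ℝ}
    (hb : 0 ≤ b) (hbc : b < c) (h : HasPiecewiseSmoothApprox g γ b)
    (h' : ∀ ε : ℝ, 0 < ε → ∃ σ : ℝ → M, ContMDiffOn 𝓘(ℝ, ℝ) (𝓡 n) ∞ σ (Icc b c) ∧
      σ b = γ b ∧ σ c = γ c ∧ (∀ t ∈ Icc b c, rDist g (γ t) (σ t) ≤ ENNReal.ofReal ε) ∧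
      ∫⁻ t in Icc b c, ENNReal.ofReal |speed g γ t - speed g σ t| ≤ ENNReal.ofReal ε) :
    HasPiecewiseSmoothApprox g γ c := by
  intro ε hε
  obtain ⟨σ₁, hcont, ⟨N, t, ht0, htN, hlt, hsm⟩, hσb, hd, hI⟩ := h (ε / 2) (half_pos hε)
  obtain ⟨σ₂, hsm', hσb', hσc, hd', hI'⟩ := h' (ε / 2) (half_pos hε)
  have hle : ENNReal.ofReal (ε / 2) ≤ ENNReal.ofReal ε := ENNReal.ofReal_le_ofReal (by linarith)
  set σ : ℝ → M := fun s ↦ if s ≤ b then σ₁ s else σ₂ s with hσ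
  have h1 {s : ℝ} (hs : s ≤ b) : σ s = σ₁ s := if_pos hs
  have h2 {s : ℝ} (hs : b ≤ s) : σ s = σ₂ s := by
    rcases hs.eq_or_lt with rfl | hs
    · rw [h1 le_rfl, hσb, hσb']
    · exact if_neg hs.not_ge
  have htb {i : ℕ} (hi : i ≤ N) : t i ≤ b := by
    rw [← htN]
    induction hi using Nat.decreasingInduction with
    | self => exact le_rfl
    | of_succ k hk ih => exact (hlt k hk).le.trans ih
  have hunion : Icc 0 b ∪ Icc b c = Icc 0 c := Icc_union_Icc_eq_Icc hb hbc.le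
  refine ⟨σ, ?_, ⟨N + 1, Function.update t (N + 1) c, ?_, by simp, fun i hi ↦ ?_,
    fun i hi ↦ ?_⟩, ?_, fun s hs ↦ ?_, ?_⟩
  · rw [← hunion]
    exact (hcont.congr fun s hs ↦ h1 hs.2).union_of_isClosed
      (hsm'.continuousOn.congr fun s hs ↦ h2 hs.1) isClosed_Icc isClosed_Icc
  · rw [Function.update_of_ne (by omega), ht0]
  · rw [Function.update_of_ne (by omega)]
    rcases Nat.lt_succ_iff_lt_or_eq.1 hi with hi' | rfl
    · rw [Function.update_of_ne (by omega)]
      exact hlt i hi'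
    · rwa [Function.update_self, htN]
  · rw [Function.update_of_ne (by omega)]
    rcases Nat.lt_succ_iff_lt_or_eq.1 hi with hi' | rfl
    · rw [Function.update_of_ne (by omega)]
      exact (hsm i hi').congr fun s hs ↦ h1 (hs.2.trans (htb hi'))
    · rw [Function.update_self, htN]
      exact hsm'.congr fun s hs ↦ h2 hs.1
  · rw [h2 hbc.le, hσc]
  · rcases le_total s b with hsb | hbs
    · rw [h1 hsb]
      exact (hd s ⟨hs.1, hsb⟩).trans hle
    · rw [h2 hbs]
      exact (hd' s ⟨hbs, hs.2⟩).trans hle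
  · have e1 : ∫⁻ t in Icc 0 b, ENNReal.ofReal |speed g γ t - speed g σ t| =
        ∫⁻ t in Icc 0 b, ENNReal.ofReal |speed g γ t - speed g σ₁ t| := by
      rw [Measure.restrict_congr_set Ioo_ae_eq_Icc.symm]
      refine setLIntegral_congr_fun measurableSet_Ioo fun s hs ↦ ?_
      have : σ =ᶠ[𝓝 s] σ₁ := by
        filter_upwards [Iio_mem_nhds hs.2] with r hr using h1 hr.le
      simp only [speed_congr this]
    have e2 : ∫⁻ t in Icc b c, ENNReal.ofReal |speed g γ t - speed g σ t| =
        ∫⁻ t in Icc b c, ENNReal.ofReal |speed g γ t - speed g σ₂ t| := by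
      rw [Measure.restrict_congr_set Ioo_ae_eq_Icc.symm]
      refine setLIntegral_congr_fun measurableSet_Ioo fun s hs ↦ ?_
      have : σ =ᶠ[𝓝 s] σ₂ := by
        filter_upwards [Ioi_mem_nhds hs.1] with r hr using h2 hr.le
      simp only [speed_congr this]
    rw [← hunion]
    refine (lintegral_union_le _ _ _).trans ?_
    rw [e1, e2, ← add_halves ε, ENNReal.ofReal_add (half_pos hε).le (half_pos hε).le]
    exact add_le_add hI hI'

theorem IsAbsolutelyContinuous.hasPiecewiseSmoothApprox (g : ContRiemannianMetric n M)
    {γ : ℝ → M} (hγ : IsAbsolutelyContinuous n γ) : HasPiecewiseSmoothApprox g γ 1 := by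
  obtain ⟨hcont, hac⟩ := hγ
  have hc : Continuous ((Icc (0 : ℝ) 1).domRestrict γ) := continuousOn_iff_continuous_domRestrict.1 hcont
  -- The subdivision is only monotone, so repeated points are skipped in the induction; it is
  -- constantly `1` from index `m` on.
  obtain ⟨t, ht0, hmono, ⟨m, hm⟩, ht⟩ := exists_monotone_Icc_subset_open_cover_unitInterval
    (c := fun p : M ↦ (Icc (0 : ℝ) 1).domRestrict γ ⁻¹' (chartAt (EuclideanSpace ℝ (Fin n)) p).source)
    (fun p ↦ (chartAt _ p).open_source.preimage hc)
    (fun s _ ↦ mem_iUnion.2 ⟨γ s, mem_chart_source _ _⟩)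
  have key (k : ℕ) : HasPiecewiseSmoothApprox g γ (t k) := by
    induction k with
    | zero => rw [ht0]; exact hasPiecewiseSmoothApprox_zero g γ
    | succ k ih =>
      have hle : (t k : ℝ) ≤ t (k + 1) := hmono k.le_succ
      rcases hle.eq_or_lt with h | h
      · rwa [← h]
      · obtain ⟨p, hp⟩ := ht k
        have hsub : Icc (t k : ℝ) (t (k + 1)) ⊆ Icc 0 1 :=
          Icc_subset_Icc (t k).2.1 (t (k + 1)).2.2
        have hmaps : MapsTo γ (Icc (t k : ℝ) (t (k + 1)))
            (chartAt (EuclideanSpace ℝ (Fin n)) p).source :=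
          fun s hs ↦ hp (a := ⟨s, hsub hs⟩) ⟨hs.1, hs.2⟩
        have hu := IsManifold.chart_mem_maximalAtlas (I := 𝓡 n) (n := ∞) p
        exact ih.append (t k).2.1 h fun ε hε ↦ exists_approx_in_chart hu h (hcont.mono hsub) hmaps
          (hac _ hu _ _ hle fun s hs ↦ ⟨hsub hs, hmaps hs⟩) hε
  have := key m
  rwa [hm m le_rfl] at this

theorem exists_piecewiseSmooth_variationalDist_lt (g : ContRiemannianMetric n M)
    (γ : ACPath n M) {ε : ℝ} (hε : 0 < ε) :
    ∃ σ ∈ piecewiseSmoothPaths n M, variationalDist g γ σ < ENNReal.ofReal ε := by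
  -- Two errors of `ε / 3` leave the inequality strict.
  obtain ⟨σ, hcont, ⟨N, t, ht0, htN, hlt, hsm⟩, -, hd, hI⟩ :=
    γ.2.hasPiecewiseSmoothApprox g (ε / 3) (by positivity)
  have hext {s : ℝ} (hs : s ∈ Icc (0 : ℝ) 1) : extend (fun s : unitInterval ↦ σ s) s = σ s :=
    IccExtend_of_mem _ _ hs
  have htmem : ∀ i ≤ N, 0 ≤ t i := by
    intro i
    induction i with
    | zero => exact fun _ ↦ ht0.ge
    | succ i ih => exact fun hi ↦ (ih (by omega)).trans (hlt i hi).le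
  have htmem' {i : ℕ} (hi : i ≤ N) : t i ≤ 1 := by
    rw [← htN]
    induction hi using Nat.decreasingInduction with
    | self => exact le_rfl
    | of_succ k hk ih => exact (hlt k hk).le.trans ih
  have hps : IsPiecewiseSmooth n (extend fun s : unitInterval ↦ σ s) :=
    ⟨hcont.congr fun s hs ↦ hext hs, N, t, ht0, htN, hlt, fun i hi ↦ (hsm i hi).congr fun s hs ↦
      hext ⟨(htmem i hi.le).trans hs.1, hs.2.trans (htmem' hi)⟩⟩
  refine ⟨⟨fun s ↦ σ s, hps.isAbsolutelyContinuous⟩, hps, ?_⟩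
  have h1 : (⨆ s : unitInterval, rDist g (γ.1 s) (σ s)) ≤ ENNReal.ofReal (ε / 3) := by
    refine iSup_le fun s ↦ ?_
    have := hd s s.2
    rwa [extend, IccExtend_val] at this
  have h2 : ∫⁻ s in Icc (0 : ℝ) 1, ENNReal.ofReal
      |speed g (extend γ.1) s - speed g (extend fun s : unitInterval ↦ σ s) s| ≤
      ENNReal.ofReal (ε / 3) := by
    refine le_of_eq_of_le ?_ hI
    rw [Measure.restrict_congr_set Ioo_ae_eq_Icc.symm]
    refine setLIntegral_congr_fun measurableSet_Ioo fun s hs ↦ ?_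
    have : (extend fun s : unitInterval ↦ σ s) =ᶠ[𝓝 s] σ := by
      filter_upwards [Icc_mem_nhds hs.1 hs.2] with r hr using hext hr
    simp only [speed_congr this]
  refine (add_le_add h1 h2).trans_lt ?_
  rw [← ENNReal.ofReal_add (by positivity) (by positivity)]
  exact (ENNReal.ofReal_lt_ofReal_iff hε).2 (by linarith)

theorem dense_piecewiseSmoothPaths (g : ContRiemannianMetric n M) :
    @Dense (ACPath n M) (variationalTopology g) (piecewiseSmoothPaths n M) := by
  let := variationalTopology g
  rw [dense_iff_inter_open]
  rintro U hU ⟨γ, hγ⟩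
  obtain ⟨ε, hε, hball⟩ := hU γ hγ
  -- The radius may be `∞`, so a smaller positive real one is taken.
  obtain ⟨r, -, hr0, hrε⟩ := ENNReal.lt_iff_exists_real_btwn.1 hε
  obtain ⟨σ, hσ, hlt⟩ := exists_piecewiseSmooth_variationalDist_lt g γ
    (ENNReal.ofReal_pos.1 hr0)
  exact ⟨σ, hball σ (hlt.trans hrε), hσ⟩

end VariationalMetric

theorem mainTheorem2 (n : ℕ) (M : Type*) [TopologicalSpace M] [T2Space M] [ConnectedSpace M]
    [ChartedSpace (EuclideanSpace ℝ (Fin n)) M] [IsManifold (𝓡 n) ∞ M]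
    (g : VariationalMetric.ContRiemannianMetric n M) :
    (∀ σ : unitInterval → M, VariationalMetric.IsPiecewiseSmooth n (VariationalMetric.extend σ) →
      VariationalMetric.IsAbsolutelyContinuous n (VariationalMetric.extend σ)) ∧
    (∀ γ : VariationalMetric.ACPath n M, ∀ ε : ℝ, 0 < ε →
      ∃ σ ∈ VariationalMetric.piecewiseSmoothPaths n M,
        VariationalMetric.variationalDist g γ σ < ENNReal.ofReal ε) ∧
    @Dense (VariationalMetric.ACPath n M) (VariationalMetric.variationalTopology g)
      (VariationalMetric.piecewiseSmoothPaths n M) :=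
  ⟨fun _ hσ ↦ hσ.isAbsolutelyContinuous,
    fun γ _ hε ↦ VariationalMetric.exists_piecewiseSmooth_variationalDist_lt g γ hε,
    VariationalMetric.dense_piecewiseSmoothPaths g⟩
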